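/- Let $\mu,\nu$ be mutually absolutely continuous probability measures on $\mathbb R$, with $\log\frac{d\mu}{d\nu}$ integrable under both, and put $$I_1=\int\log\tfrac{d\mu}{d\nu}\,d\mu,\qquad I_0=-\int\log\tfrac{d\mu}{d\nu}\,d\nu,\qquad I=\min\{I_0,I_1\},$$ with $0<I_0,I_1<\infty$. There are $s$ sensors; in state $\theta\in\{0,1\}$ the true observations $x_i(k)$ ($1\le i\le s$, $k\ge 1$) are i.i.d. with law $\nu$ if $\theta=0$ and $\mu$ if $\theta=1$. An admissible attack $g$ on a fixed set $\mathcal C$ of $c$ sensors replaces $x(k)$ by $x'(k)=x(k)+x^a(k)$, where $x^a(k)\in\mathbb R^s$ vanishes outside $\mathcal C$ and is a measurable function of $\theta$, $k$, the true observations of the sensors in $\mathcal C$ at times $1,\dots,k$, the earlier vectors $x^a(1),\dots,x^a(k-1)$, and possibly private randomness that is independent of the observations. Let $\mathbb P^g_\theta,\mathbb E^g_\theta$ be the resulting probability and expectation. Let $S_i(n)=\sum_{k=1}^n\log\frac{d\mu}{d\nu}(x'_i(k))$. For $a,b>0$ let $\tau_i^+(b)=\inf\{n\ge1:S_i(n)\ge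 b\}$ and $\tau_i^-(a)=\inf\{n\ge1:S_i(n)\le -a\}$, and let $\tau^{\pm}_{(r)}$ be the $r$-th smallest of the $s$ times $\tau^\pm_i$. The voting rule $f^{(r)}$ stops at $T=\min\{\tau^-_{(r)}(a),\tau^+_{(r)}(b)\}$ and accepts $H_0$ if $\tau^-_{(r)}(a)<\tau^+_{(r)}(b)$, $H_1$ if $\tau^+_{(r)}(b)<\tau^-_{(r)}(a)$, and the outcome of an independent fair coin if the two are equal and finite. Let $\alpha=\mathbb P^g_0[\text{accept }H_1]$, $\beta=\mathbb P^g_1[\text{accept }H_0]$, $D(T)=\max_{\theta}\mathbb E^g_\theta[T]$, and $$\gamma(f^{(r)},g)=\liminf_{\alpha=\beta\to0^+}\frac{\log(1/\alpha)}{D(T)},$$ the lower limit being over the thresholds $a,b>0$ with $\alpha=\beta$ (and $+\infty$ if $\alpha=\beta$ does not take arbitrarily small positive values). Suppose that only an upper bound $\bar c<s/2$ on the number of compromised sensors is known and that the actual number is $c\le\bar c$. Then the voting rule $\tilde f=f^{(s-\bar c)}$ satisfies, under every admissible attack $g$, $$\gamma(\tilde f,g)\ \ge\ (s-\bar c-c)\,I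 .$$ The same bound holds along equal thresholds: as $a=b\to\infty$, $\alpha\to0$ and $\beta\to0$, and $$\liminf_{a=b\to\infty}\frac{\log\left(1/\max\{\alpha,\beta\}\right)}{D(T)}\ \ge\ (s-\bar c-c)\,I .$$ -/

import Mathlib

open MeasureTheory Filter Topology
open scoped ENNReal

namespace ByzantineDetection

noncomputable section

/-- The Kullback–Leibler divergence `I₁ = ∫ log (dμ/dν) dμ`. -/
def klOne (μ ν : Measure ℝ) : ℝ := ∫ x, llr μ ν x ∂μ

/-- The Kullback–Leibler divergence `I₀ = -∫ log (dμ/dν) dν`. -/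
def klZero (μ ν : Measure ℝ) : ℝ := -∫ x, llr μ ν x ∂ν

/-- `I = min {I₀, I₁}`. -/
def klMin (μ ν : Measure ℝ) : ℝ := min (klZero μ ν) (klOne μ ν)

/-- The law of one honest observation: `ν` in state `0` (`false`), `μ` in state `1` (`true`). -/
def obsLaw (μ ν : Measure ℝ) : Bool → Measure ℝ
  | false => ν
  | true => μ

/-- The first `k` terms of a sequence. -/
def hist {α : Type*} (x : ℕ → α) (k : ℕ) : Fin k → α := fun j => x j

/-- An admissible attack on `s` sensors, possibly randomized through a private seed in `R`.
Index `k` stands for time `k + 1`.  The bias at that time is a measurable function of the state `θ`,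
the time, the seed, the true observations of the compromised sensors up to and including that time,
and all earlier bias vectors; it vanishes at every sensor outside the fixed set `compromised`. -/
structure Attack (s : ℕ) (R : Type*) [MeasurableSpace R] where
  compromised : Finset (Fin s)
  bias : Bool → (k : ℕ) → R → (Fin (k + 1) → compromised → ℝ) → (Fin k → Fin s → ℝ) →
    (Fin s → ℝ)
  measurable_bias : ∀ θ k, Measurable
    (fun p : R × (Fin (k + 1) → compromised → ℝ) × (Fin k → Fin s → ℝ) =>
      bias θ k p.1 p.2.1 p.2.2)
  sparse : ∀ θ k w X A i, i ∉ compromised → bias θ k w X A i = 0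

namespace Attack

variable {s : ℕ} {R : Type*} [MeasurableSpace R]

/-- The true observations of the compromised sensors at times `1, …, k`. -/
def visible (g : Attack s R) (x : ℕ → Fin s → ℝ) (k : ℕ) : Fin k → g.compromised → ℝ :=
  fun j i => x j i

/-- The bias vectors injected at times `1, …, k`. -/
def biasHist (g : Attack s R) (θ : Bool) (w : R) (x : ℕ → Fin s → ℝ) :
    (k : ℕ) → (Fin k → Fin s → ℝ)
  | 0 => Fin.elim0
  | k + 1 => Fin.snoc (α := fun _ => Fin s → ℝ) (biasHist g θ w x k)
      (g.bias θ k w (visible g x (k + 1)) (biasHist g θ w x k))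

/-- The bias vector injected at time `k + 1`. -/
def biasAt (g : Attack s R) (θ : Bool) (w : R) (x : ℕ → Fin s → ℝ) (k : ℕ) : Fin s → ℝ :=
  g.bias θ k w (visible g x (k + 1)) (biasHist g θ w x k)

/-- The manipulated observations, `x'(k) = x(k) + xᵃ(k)`. -/
def received (g : Attack s R) (θ : Bool) (w : R) (x : ℕ → Fin s → ℝ) : ℕ → Fin s → ℝ :=
  fun k i => x k i + biasAt g θ w x k i

end Attack

/-- A detection strategy: `f coin k X` is the decision at time `k ≥ 1` from the `k` received
observation vectors `X` and a fair coin; `none` means continue, `some false` and `some true` mean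
stop and accept hypothesis `0` and `1`. -/
abbrev Detector (s : ℕ) : Type := Bool → (k : ℕ) → (Fin k → Fin s → ℝ) → Option Bool

/-- The time `T` at which the test terminates (`⊤` if it never does). -/
def stopTime {s : ℕ} (f : Detector s) (coin : Bool) (y : ℕ → Fin s → ℝ) : ℕ∞ :=
  ⨅ (k : ℕ) (_ : 1 ≤ k ∧ f coin k (hist y k) ≠ none), (k : ℕ∞)

/-- The test terminates at some time `T = k`, with decision `f_T = d`. -/
def Decides {s : ℕ} (f : Detector s) (coin : Bool) (y : ℕ → Fin s → ℝ) (d : Bool) : Prop :=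
  ∃ k : ℕ, stopTime f coin y = k ∧ f coin k (hist y k) = some d

/-- The law in state `θ` of the detector's fair coin, the attacker's private seed (of law `ρ`) and
the true observations, all independent, the true observations being i.i.d. over sensors and time. -/
def jointLaw (s : ℕ) {R : Type*} [MeasurableSpace R] (μ ν : Measure ℝ)
    [IsProbabilityMeasure μ] [IsProbabilityMeasure ν] (ρ : Measure R) (θ : Bool) :
    Measure (Bool × R × (ℕ → Fin s → ℝ)) :=
  (PMF.uniformOfFintype Bool).toMeasure.prod
    (ρ.prod (Measure.infinitePi fun _ : ℕ => Measure.pi fun _ : Fin s => obsLaw μ ν θ))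

section Performance

variable {s : ℕ} {R : Type*} [MeasurableSpace R] (μ ν : Measure ℝ)
  [IsProbabilityMeasure μ] [IsProbabilityMeasure ν] (ρ : Measure R)

/-- The probability, in state `θ` and under the attack `g`, that `f` accepts hypothesis `d`. -/
def probDecides (f : Detector s) (g : Attack s R) (θ d : Bool) : ℝ≥0∞ :=
  jointLaw s μ ν ρ θ {ω | Decides f ω.1 (g.received θ ω.2.1 ω.2.2) d}

/-- The type-I error probability `α`. -/
def typeI (f : Detector s) (g : Attack s R) : ℝ≥0∞ := probDecides μ ν ρ f g false true

/-- The type-II error probability `β`. -/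
def typeII (f : Detector s) (g : Attack s R) : ℝ≥0∞ := probDecides μ ν ρ f g true false

/-- The expected stopping time in state `θ` under the attack `g`. -/
def meanStop (f : Detector s) (g : Attack s R) (θ : Bool) : ℝ≥0∞ :=
  ∫⁻ ω, (stopTime f ω.1 (g.received θ ω.2.1 ω.2.2) : ℝ≥0∞) ∂(jointLaw s μ ν ρ θ)

/-- The worst-case average sample number `D(T)`, the larger of the two expectations. -/
def delay (f : Detector s) (g : Attack s R) : ℝ≥0∞ :=
  max (meanStop μ ν ρ f g false) (meanStop μ ν ρ f g true)

/-- The ratio `log (1 / p) / D(T)`. -/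
def efficiency (f : Detector s) (g : Attack s R) (p : ℝ≥0∞) : EReal :=
  ENNReal.log p⁻¹ / (delay μ ν ρ f g : EReal)

/-- The performance `γ(f, g)` of a family of tests `F`, indexed by its design parameters: the lower
limit of `log (1 / α) / D(T)` over the parameters with `α = β`, as `α = β → 0⁺`. -/
def gamma {ι : Type*} (F : ι → Detector s) (g : Attack s R) : EReal :=
  liminf (fun t => efficiency μ ν ρ (F t) g (typeI μ ν ρ (F t) g))
    (comap (fun t => typeI μ ν ρ (F t) g) (𝓝[>] 0) ⊓
      𝓟 {t | typeI μ ν ρ (F t) g = typeII μ ν ρ (F t) g})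

end Performance

section Voting

variable {s : ℕ} (μ ν : Measure ℝ)

/-- The cumulative log-likelihood ratio `S_i(n)`, for `n ≤ k`, of the received observations. -/
def cumLLR {k : ℕ} (X : Fin k → Fin s → ℝ) (i : Fin s) (n : ℕ) : ℝ :=
  ∑ j : Fin k, if (j : ℕ) < n then llr μ ν (X j i) else 0

/-- `τ⁺_i(b)`, as far as it is visible at time `k`: the first time `1 ≤ n ≤ k` with `S_i(n) ≥ b`,
and `⊤` if there is none. -/
def tauPlus (b : ℝ) {k : ℕ} (X : Fin k → Fin s → ℝ) (i : Fin s) : ℕ∞ :=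
  ⨅ (n : ℕ) (_ : 1 ≤ n ∧ n ≤ k ∧ b ≤ cumLLR μ ν X i n), (n : ℕ∞)

/-- `τ⁻_i(a)`, as far as it is visible at time `k`: the first time `1 ≤ n ≤ k` with `S_i(n) ≤ -a`,
and `⊤` if there is none. -/
def tauMinus (a : ℝ) {k : ℕ} (X : Fin k → Fin s → ℝ) (i : Fin s) : ℕ∞ :=
  ⨅ (n : ℕ) (_ : 1 ≤ n ∧ n ≤ k ∧ cumLLR μ ν X i n ≤ -a), (n : ℕ∞)

/-- The `r`-th smallest of the values `τ i`. -/
def orderStat (r : ℕ) (τ : Fin s → ℕ∞) : ℕ∞ :=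
  ⨅ (t : ℕ∞) (_ : r ≤ (Finset.univ.filter fun i => τ i ≤ t).card), t

/-- The voting rule `f^{(r)}` with thresholds `-a < 0 < b`.  Times later than
`min {τ⁻_(r)(a), τ⁺_(r)(b)}`, when the test has already stopped, get the irrelevant value `none`. -/
def voting (r : ℕ) (a b : ℝ) : Detector s := fun coin k X =>
  let tm := orderStat r (tauMinus μ ν a X)
  let tp := orderStat r (tauPlus μ ν b X)
  if (k : ℕ∞) < min tm tp then none
  else if (k : ℕ∞) = tm ∧ tm < tp then some false
  else if (k : ℕ∞) = tp ∧ tp < tm then some true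
  else if (k : ℕ∞) = tp ∧ tp = tm then some coin
  else none

/-- The pairs of thresholds `(a, b)` with `a, b > 0`. -/
abbrev Thresholds : Type := {p : ℝ × ℝ // 0 < p.1 ∧ 0 < p.2}

/-- The voting rule `f^{(r)}` as a family of tests indexed by its thresholds. -/
def votingFamily (s r : ℕ) (p : Thresholds) : Detector s := voting μ ν r p.1.1 p.1.2

end Voting

end

end ByzantineDetection

/-! Put r = s - c̄ and κ = s - c̄ - c > 0. Honest sensors report their true observations, so their
walks do not depend on the attack. Error: a wrong decision needs r walks across the wrong threshold
e, at least κ of them honest. The exponential of a step in the wrong direction has mean at most 1,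
so κ given honest walks all reach e with probability at most exp(-κe); a union over κ-subsets costs
a factor of at most 2^s (`measure_crossSet_le`, `probDecides_not_voting_le`). Delay: the s - c ≥ r
honest sensors suffice to stop the test. For η below the drift, Chernoff's bound makes the chance
that some true walk is still below e at time n decay geometrically once n ≥ e/η, so the mean
stopping time is at most e/η + K (`exists_meanStop_voting_le`). With m = max a b, the relevant error
p thus satisfies log(1/p) ≥ κm - C, while D(T) ≤ m/η + K. Letting η tend to I gives the rate κI
(`le_log_inv_div`). -/

namespace ByzantineDetection

/-! ### Infinite products: splitting off the first coordinate. -/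

section ProductSpace

variable {α : Type*} [MeasurableSpace α]

/-- The sequence that starts with `p.1` and goes on with `p.2`. -/
def consSeq (p : α × (ℕ → α)) : ℕ → α := fun n => Nat.casesOn n p.1 p.2

lemma measurable_consSeq : Measurable (consSeq (α := α)) := by
  refine measurable_pi_lambda _ fun n => ?_
  cases n with
  | zero => exact measurable_fst
  | succ n => exact (measurable_pi_apply n).comp measurable_snd

lemma measurePreserving_consSeq (P : Measure α) [IsProbabilityMeasure P] :
    MeasurePreserving consSeq (P.prod (Measure.infinitePi fun _ : ℕ => P))
      (Measure.infinitePi fun _ : ℕ => P) := by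
  refine ⟨measurable_consSeq, Measure.eq_infinitePi _ fun S t ht => ?_⟩
  rw [Measure.map_apply measurable_consSeq (.pi S.countable_toSet fun i _ => ht i)]
  set S' : Finset ℕ := S.preimage Nat.succ Nat.succ_injective.injOn with hS'
  -- The implication makes the first factor the whole space when 0 ∉ S.
  have key : consSeq ⁻¹' (Set.pi S t) =
      {a | 0 ∈ S → a ∈ t 0} ×ˢ Set.pi S' fun i => t (i + 1) := by
    ext ⟨a, x⟩
    simp only [Set.mem_preimage, Set.mem_pi, Finset.mem_coe, Set.mem_prod, Set.mem_ofPred_eq, hS',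
      Finset.mem_preimage]
    constructor
    · exact fun h => ⟨fun h0 => h 0 h0, fun i hi => h (i + 1) hi⟩
    · rintro ⟨h0, h⟩ (_ | i) hi
      · exact h0 hi
      · exact h i hi
  rw [key, Measure.prod_prod, Measure.infinitePi_pi _ fun i _ => ht (i + 1)]
  have himg : ∏ i ∈ S', P (t (i + 1)) = ∏ i ∈ S.erase 0, P (t i) := by
    rw [hS']
    refine Finset.prod_bij (fun i _ => i + 1) ?_ (by simp) ?_ (by simp)
    · simp
    · intro b hb
      rw [Finset.mem_erase] at hb
      obtain ⟨n, rfl⟩ := Nat.exists_eq_succ_of_ne_zero hb.1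
      exact ⟨n, by simpa using hb.2, rfl⟩
  rw [himg]
  by_cases h0 : 0 ∈ S
  · simp only [h0, true_imp_iff, Set.ofPred_mem_eq]
    exact Finset.mul_prod_erase S (fun i => P (t i)) h0
  · simp [h0]

lemma lintegral_infinitePi_cons (P : Measure α) [IsProbabilityMeasure P]
    {f : (ℕ → α) → ℝ≥0∞} (hf : Measurable f) :
    ∫⁻ x, f x ∂(Measure.infinitePi fun _ : ℕ => P) =
      ∫⁻ a, ∫⁻ x, f (consSeq (a, x)) ∂(Measure.infinitePi fun _ : ℕ => P) ∂P := by
  rw [← (measurePreserving_consSeq P).lintegral_comp hf]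
  exact lintegral_prod _ (hf.comp measurable_consSeq).aemeasurable

lemma infinitePi_apply_cons (P : Measure α) [IsProbabilityMeasure P]
    {E : Set (ℕ → α)} (hE : MeasurableSet E) :
    Measure.infinitePi (fun _ : ℕ => P) E =
      ∫⁻ a, Measure.infinitePi (fun _ : ℕ => P) {x | consSeq (a, x) ∈ E} ∂P := by
  rw [← (measurePreserving_consSeq P).measure_preimage hE.nullMeasurableSet,
    Measure.prod_apply (measurable_consSeq hE)]
  rfl

lemma lintegral_infinitePi_prod_range (P : Measure α) [IsProbabilityMeasure P]
    {h : α → ℝ≥0∞} (hh : Measurable h) (n : ℕ) :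
    ∫⁻ x, ∏ j ∈ Finset.range n, h (x j) ∂(Measure.infinitePi fun _ : ℕ => P) =
      (∫⁻ a, h a ∂P) ^ n := by
  induction n with
  | zero => simp
  | succ n ih =>
    have hm : ∀ n, Measurable fun x : ℕ → α => ∏ j ∈ Finset.range n, h (x j) := fun n => by
      fun_prop
    rw [lintegral_infinitePi_cons P (hm _)]
    have : ∀ a (x : ℕ → α), ∏ j ∈ Finset.range (n + 1), h (consSeq (a, x) j) =
        h a * ∏ j ∈ Finset.range n, h (x j) := fun a x => by
      rw [Finset.prod_range_succ', mul_comm]; rfl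
    simp_rw [this]
    simp_rw [lintegral_const_mul _ (hm n), ih]
    rw [lintegral_mul_const _ hh, pow_succ']

lemma lintegral_pi_eval {s : ℕ} (P : Measure α) [IsProbabilityMeasure P]
    {h : α → ℝ≥0∞} (hh : Measurable h) (i : Fin s) :
    ∫⁻ y, h (y i) ∂(Measure.pi fun _ : Fin s => P) = ∫⁻ a, h a ∂P :=
  (measurePreserving_eval (fun _ : Fin s => P) i).lintegral_comp hh

lemma lintegral_pi_prod {s : ℕ} (P : Measure α) [IsProbabilityMeasure P]
    {h : α → ℝ≥0∞} (hh : Measurable h) (A : Finset (Fin s)) :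
    ∫⁻ y, ∏ i ∈ A, h (y i) ∂(Measure.pi fun _ : Fin s => P) = (∫⁻ a, h a ∂P) ^ A.card := by
  have := ProbabilityTheory.lintegral_prod_eq_prod_lintegral_of_indepFun A
    (fun i (y : Fin s → α) => h (y i))
    (ProbabilityTheory.iIndepFun_pi (μ := fun _ : Fin s => P) fun _ => hh.aemeasurable)
    fun i => hh.comp (measurable_pi_apply i)
  rw [this]
  simp [lintegral_pi_eval P hh]

end ProductSpace
-- Crossing probabilities and lower tails of independent walks.
section Walk

variable {s : ℕ}

/-- The random walk with increments `ψ (x j i)`. -/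
def walk (ψ : ℝ → ℝ) (x : ℕ → Fin s → ℝ) (i : Fin s) (n : ℕ) : ℝ :=
  ∑ j ∈ Finset.range n, ψ (x j i)

lemma measurable_walk {ψ : ℝ → ℝ} (hψ : Measurable ψ) (i : Fin s) (n : ℕ) :
    Measurable fun x => walk ψ x i n := by
  unfold walk
  fun_prop

lemma walk_consSeq_succ (ψ : ℝ → ℝ) (y : Fin s → ℝ) (x : ℕ → Fin s → ℝ) (i : Fin s) (n : ℕ) :
    walk ψ (consSeq (y, x)) i (n + 1) = ψ (y i) + walk ψ x i n := by
  rw [walk, Finset.sum_range_succ', add_comm]; rfl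

/-- The event that every walk in `A` reaches its own level within `n` steps. -/
def crossSet (ψ : ℝ → ℝ) (A : Finset (Fin s)) (b : Fin s → ℝ) (n : ℕ) :
    Set (ℕ → Fin s → ℝ) :=
  {x | ∀ i ∈ A, ∃ k ≤ n, b i ≤ walk ψ x i k}

lemma measurableSet_crossSet {ψ : ℝ → ℝ} (hψ : Measurable ψ) (A : Finset (Fin s))
    (b : Fin s → ℝ) (n : ℕ) : MeasurableSet (crossSet ψ A b n) := by
  have : crossSet ψ A b n = ⋂ i ∈ A, ⋃ k ∈ Set.Iic n, {x | b i ≤ walk ψ x i k} := by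
    ext x; simp [crossSet]
  rw [this]
  exact Finset.measurableSet_biInter _ fun i _ => MeasurableSet.biUnion (Set.to_countable _)
    fun k _ => measurableSet_le measurable_const (measurable_walk hψ i k)

/-- Nonpositive levels contribute factors at least 1. The induction below can therefore discard
walks that are at their level from the start. -/
lemma prod_ofReal_exp_neg_filter_pos_le (A : Finset (Fin s)) (b : Fin s → ℝ) :
    ∏ i ∈ A with 0 < b i, ENNReal.ofReal (Real.exp (-b i)) ≤
      ∏ i ∈ A, ENNReal.ofReal (Real.exp (-b i)) := by
  rw [Finset.prod_filter]
  refine Finset.prod_le_prod' fun i _ => ?_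
  split_ifs with h
  · exact le_rfl
  · rw [ENNReal.one_le_ofReal, Real.one_le_exp_iff]
    linarith

/-- Independent walks with `E exp ψ ≤ 1` all reach their levels `b i` with probability at most
`exp (-∑ b i)`. -/
lemma measure_crossSet_le (P : Measure ℝ) [IsProbabilityMeasure P] {ψ : ℝ → ℝ}
    (hψ : Measurable ψ) (hP : ∫⁻ t, ENNReal.ofReal (Real.exp (ψ t)) ∂P ≤ 1) (n : ℕ)
    (A : Finset (Fin s)) (b : Fin s → ℝ) :
    Measure.infinitePi (fun _ : ℕ => Measure.pi fun _ : Fin s => P) (crossSet ψ A b n) ≤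
      ∏ i ∈ A, ENNReal.ofReal (Real.exp (-b i)) := by
  -- After a first step y the remaining levels are `b i - ψ (y i)`, which differ between sensors;
  -- hence the general `b`.
  induction n generalizing A b with
  | zero =>
    by_cases h : ∀ i ∈ A, b i ≤ 0
    · refine prob_le_one.trans (Finset.one_le_prod' fun i hi => ?_)
      rw [ENNReal.one_le_ofReal, Real.one_le_exp_iff]
      linarith [h i hi]
    · have : crossSet ψ A b 0 = ∅ := by
        refine Set.eq_empty_of_forall_notMem fun x hx => h fun i hi => ?_
        obtain ⟨k, hk, hb⟩ := hx i hi
        obtain rfl := Nat.le_zero.1 hk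
        simpa [walk] using hb
      simp [this]
  | succ n ih =>
    set A' := A.filter fun i => 0 < b i with hA'
    rw [infinitePi_apply_cons _ (measurableSet_crossSet hψ A b (n + 1))]
    calc _ ≤ ∫⁻ y, (∏ i ∈ A', ENNReal.ofReal (Real.exp (-b i))) *
            ∏ i ∈ A', ENNReal.ofReal (Real.exp (ψ (y i))) ∂(Measure.pi fun _ : Fin s => P) := by
          refine lintegral_mono fun y => ?_
          refine (measure_mono ?_).trans ((ih A' fun i => b i - ψ (y i)).trans_eq ?_)
          · intro x hx i hi
            obtain ⟨hiA, hpos⟩ := Finset.mem_filter.1 hi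
            obtain ⟨_ | k, hk, hb⟩ := hx i hiA
            · simp only [walk, Finset.range_zero, Finset.sum_empty] at hb
              linarith
            · rw [walk_consSeq_succ] at hb
              exact ⟨k, by omega, by linarith⟩
          · rw [← Finset.prod_mul_distrib]
            refine Finset.prod_congr rfl fun i _ => ?_
            rw [← ENNReal.ofReal_mul (Real.exp_nonneg _), ← Real.exp_add]
            congr 2; ring
      _ = (∏ i ∈ A', ENNReal.ofReal (Real.exp (-b i))) *
            (∫⁻ t, ENNReal.ofReal (Real.exp (ψ t)) ∂P) ^ A'.card := by
          rw [lintegral_const_mul _ (by fun_prop), lintegral_pi_prod P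
            (h := fun t => ENNReal.ofReal (Real.exp (ψ t))) (by fun_prop)]
      _ ≤ ∏ i ∈ A', ENNReal.ofReal (Real.exp (-b i)) :=
          mul_le_of_le_one_right' (pow_le_one' hP _)
      _ ≤ _ := prod_ofReal_exp_neg_filter_pos_le A b

/-- Finitely many crossing times have a common bound, so continuity from below removes the horizon
n. -/
lemma measure_forall_exists_le_walk_le (P : Measure ℝ) [IsProbabilityMeasure P] {ψ : ℝ → ℝ}
    (hψ : Measurable ψ) (hP : ∫⁻ t, ENNReal.ofReal (Real.exp (ψ t)) ∂P ≤ 1)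
    (A : Finset (Fin s)) (b : ℝ) :
    Measure.infinitePi (fun _ : ℕ => Measure.pi fun _ : Fin s => P)
        {x | ∀ i ∈ A, ∃ k, b ≤ walk ψ x i k} ≤
      ENNReal.ofReal (Real.exp (-(A.card * b))) := by
  have hU : {x : ℕ → Fin s → ℝ | ∀ i ∈ A, ∃ k, b ≤ walk ψ x i k} =
      ⋃ n, crossSet ψ A (fun _ => b) n := by
    ext x
    simp only [Set.mem_iUnion, crossSet, Set.mem_ofPred_eq]
    constructor
    · intro h
      choose! k hk using h
      exact ⟨A.sup k, fun i hi => ⟨k i, Finset.le_sup hi, hk i hi⟩⟩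
    · rintro ⟨n, h⟩ i hi
      obtain ⟨k, -, hk⟩ := h i hi
      exact ⟨k, hk⟩
  have hmono : Monotone (crossSet ψ A fun _ => b) := fun m n hmn x hx i hi => by
    obtain ⟨k, hk, h⟩ := hx i hi
    exact ⟨k, hk.trans hmn, h⟩
  rw [hU, hmono.measure_iUnion]
  refine iSup_le fun n => (measure_crossSet_le P hψ hP n A _).trans_eq ?_
  rw [Finset.prod_const, ← ENNReal.ofReal_pow (Real.exp_nonneg _), ← Real.exp_nat_mul]
  congr 2; ring

/-- If `E Y > 0` and `E exp (-Y) < ∞` then `E exp (-λ Y) < 1` for some `λ > 0`. -/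
lemma exists_integral_exp_neg_mul_lt_one (P : Measure ℝ) [IsProbabilityMeasure P] {Y : ℝ → ℝ}
    (hY : Integrable Y P) (hexp : Integrable (fun t => Real.exp (-Y t)) P)
    (hpos : 0 < ∫ t, Y t ∂P) :
    ∃ l : ℝ, 0 < l ∧ Integrable (fun t => Real.exp (-(l * Y t))) P ∧
      ∫ t, Real.exp (-(l * Y t)) ∂P < 1 := by
  -- Convexity of exp between 0 and -y; this dominates the difference quotients below uniformly in
  -- l.
  have hlow : ∀ (l y : ℝ), 0 ≤ l → l ≤ 1 →
      Real.exp (-(l * y)) - 1 ≤ l * Real.exp (-y) := fun l y h0 h1 => by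
    have := convexOn_exp.2 (Set.mem_univ 0) (Set.mem_univ (-y)) (sub_nonneg.2 h1) h0 (by ring)
    simp only [smul_eq_mul, mul_zero, zero_add, Real.exp_zero, mul_one, mul_neg] at this
    linarith
  set l : ℕ → ℝ := fun n => 1 / ((n : ℝ) + 1) with hl
  have hl0 : ∀ n, 0 < l n := fun n => Nat.one_div_pos_of_nat
  have hl1 : ∀ n, l n ≤ 1 := fun n => by
    rw [hl]
    exact div_le_one_of_le₀ (by linarith [n.cast_nonneg (α := ℝ)]) (by positivity)
  have hlim : Tendsto l atTop (𝓝[≠] 0) :=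
    tendsto_nhdsWithin_iff.2 ⟨tendsto_one_div_add_atTop_nhds_zero_nat,
      Eventually.of_forall fun n => (hl0 n).ne'⟩
  have hint : ∀ n, Integrable (fun t => Real.exp (-(l n * Y t))) P := fun n => by
    refine ((integrable_const (1 : ℝ)).add hexp).mono'
      (Real.continuous_exp.comp_aestronglyMeasurable (hY.1.const_mul _).neg)
      (Eventually.of_forall fun t => ?_)
    rw [Real.norm_eq_abs, Real.abs_exp]
    have h1 := hlow (l n) (Y t) (hl0 n).le (hl1 n)
    have h2 := mul_le_of_le_one_left (Real.exp_nonneg (-Y t)) (hl1 n)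
    simp only [Pi.add_apply]
    linarith
  -- This differentiates the Laplace transform at 0 along `l n`; a positive limit forces a positive
  -- quotient for some n.
  have hT : Tendsto (fun n => ∫ t, (1 - Real.exp (-(l n * Y t))) / l n ∂P) atTop
      (𝓝 (∫ t, Y t ∂P)) := by
    refine tendsto_integral_of_dominated_convergence (fun t => |Y t| + Real.exp (-Y t))
      (fun n => (((integrable_const (1 : ℝ)).sub (hint n)).div_const _).1) (hY.abs.add hexp)
      (fun n => Eventually.of_forall fun t => ?_) (Eventually.of_forall fun t => ?_)
    · rw [Real.norm_eq_abs, abs_le, div_le_iff₀ (hl0 n), le_div_iff₀ (hl0 n)]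
      have h1 := hlow (l n) (Y t) (hl0 n).le (hl1 n)
      have h2 := Real.add_one_le_exp (-(l n * Y t))
      have h3 := mul_le_mul_of_nonneg_left (le_abs_self (Y t)) (hl0 n).le
      have h4 := mul_nonneg (hl0 n).le (abs_nonneg (Y t))
      have h5 := mul_nonneg (hl0 n).le (Real.exp_nonneg (-Y t))
      constructor <;> nlinarith
    · have hd : HasDerivAt (fun u : ℝ => -Real.exp (-(u * Y t))) (Y t) 0 := by
        have : HasDerivAt (fun u : ℝ => -Real.exp (-(u * Y t)))
            (-(Real.exp (-(0 * Y t)) * -(1 * Y t))) 0 :=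
          ((hasDerivAt_id (0 : ℝ)).mul_const (Y t)).neg.exp.neg
        simpa using this
      have := hd.tendsto_slope_zero.comp hlim
      refine this.congr fun n => ?_
      simp only [Function.comp, zero_add, zero_mul, neg_zero, Real.exp_zero, smul_eq_mul]
      rw [div_eq_inv_mul]; ring
  obtain ⟨n, hn⟩ := (hT.eventually (lt_mem_nhds hpos)).exists
  refine ⟨l n, hl0 n, hint n, ?_⟩
  rw [integral_div, integral_sub (integrable_const _) (hint n)] at hn
  have := (div_pos_iff_of_pos_right (hl0 n)).1 hn
  simp at this
  exact this

/-- Chernoff's bound for the lower tail of a walk with drift larger than `η`. -/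
lemma exists_measure_walk_lt_le (P : Measure ℝ) [IsProbabilityMeasure P] {φ : ℝ → ℝ}
    (hφ : Measurable φ) (hint : Integrable φ P)
    (hP : ∫⁻ t, ENNReal.ofReal (Real.exp (-φ t)) ∂P ≤ 1) {η : ℝ} (hη : η < ∫ t, φ t ∂P) :
    ∃ q : ℝ≥0∞, q < 1 ∧ ∀ (n : ℕ) (b : ℝ) (i : Fin s), b ≤ n * η →
      Measure.infinitePi (fun _ : ℕ => Measure.pi fun _ : Fin s => P)
        {x | walk φ x i n < b} ≤ q ^ n := by
  have hexp : Integrable (fun t => Real.exp (-φ t)) P := by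
    refine ⟨by fun_prop, ?_⟩
    rw [hasFiniteIntegral_iff_ofReal (Eventually.of_forall fun t => Real.exp_nonneg _)]
    exact hP.trans_lt ENNReal.one_lt_top
  obtain ⟨l, hl, hli, hlt⟩ := exists_integral_exp_neg_mul_lt_one P
    (Y := fun t => φ t - η) (hint.sub (integrable_const _))
    ((hexp.const_mul (Real.exp η)).congr (Eventually.of_forall fun t => by
      simp only; rw [← Real.exp_add]; congr 1; ring))
    (by rw [integral_sub hint (integrable_const _)]; simpa using hη)
  refine ⟨∫⁻ t, ENNReal.ofReal (Real.exp (-(l * (φ t - η)))) ∂P, ?_, fun n b i hb => ?_⟩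
  · rw [← ofReal_integral_eq_lintegral_ofReal hli
      (Eventually.of_forall fun t => Real.exp_nonneg _)]
    exact ENNReal.ofReal_lt_one.2 hlt
  · set h : (Fin s → ℝ) → ℝ≥0∞ := fun y => ENNReal.ofReal (Real.exp (-(l * (φ (y i) - η)))) with hh
    have hhm : Measurable h := by fun_prop
    have hprod := lintegral_infinitePi_prod_range (Measure.pi fun _ : Fin s => P) hhm n
    rw [hh, lintegral_pi_eval P (h := fun t => ENNReal.ofReal (Real.exp (-(l * (φ t - η)))))
      (by fun_prop)] at hprod
    rw [← hprod]
    -- Markov's inequality at level 1: if the walk is below `b ≤ n * η`, the sum of the φ - η is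
    -- negative and the product of exponentials is at least 1.
    refine le_trans ?_ (meas_ge_le_lintegral_div (ε := 1)
      (Finset.measurable_fun_prod _ fun j _ => hhm.comp (measurable_pi_apply j)).aemeasurable one_ne_zero
      ENNReal.one_ne_top |>.trans_eq (div_one _))
    refine measure_mono fun x hx => ?_
    simp only [Set.mem_ofPred_eq] at hx ⊢
    change 1 ≤ ∏ j ∈ Finset.range n, ENNReal.ofReal (Real.exp (-(l * (φ (x j i) - η))))
    rw [← ENNReal.ofReal_prod_of_nonneg fun j _ => Real.exp_nonneg _, ← Real.exp_sum,
      ENNReal.one_le_ofReal, Real.one_le_exp_iff, Finset.sum_neg_distrib, ← Finset.mul_sum,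
      Finset.sum_sub_distrib, Left.nonneg_neg_iff]
    refine mul_nonpos_of_nonneg_of_nonpos hl.le ?_
    simp only [Finset.sum_const, Finset.card_range, nsmul_eq_mul]
    unfold walk at hx
    linarith

end Walk
-- The voting rule in terms of threshold crossings.
section VotingRule

variable {s : ℕ}

lemma iInf_natCast_le_iff {p : ℕ → Prop} {n : ℕ} :
    ⨅ (k : ℕ) (_ : p k), (k : ℕ∞) ≤ n ↔ ∃ k ≤ n, p k := by
  constructor
  · intro h
    by_contra! hne
    have : ((n + 1 : ℕ) : ℕ∞) ≤ ⨅ (k : ℕ) (_ : p k), (k : ℕ∞) :=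
      le_iInf₂ fun k hk => Nat.cast_le.2 (by
        by_contra hlt
        exact hne k (by omega) hk)
    have := Nat.cast_le.1 (this.trans h)
    omega
  · rintro ⟨k, hk, hp⟩
    exact (iInf₂_le k hp).trans (Nat.cast_le.2 hk)

/-- The infimum is attained because ℕ∞ is well-ordered; r ≤ s puts ⊤ in the set. -/
lemma orderStat_le_iff {r : ℕ} (hr : r ≤ s) (τ : Fin s → ℕ∞) (t : ℕ∞) :
    orderStat r τ ≤ t ↔ r ≤ (Finset.univ.filter fun i => τ i ≤ t).card := by
  have hmem : orderStat r τ ∈ {t | r ≤ (Finset.univ.filter fun i => τ i ≤ t).card} := by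
    have : orderStat r τ = sInf {t | r ≤ (Finset.univ.filter fun i => τ i ≤ t).card} := by
      rw [sInf_eq_iInf]; rfl
    rw [this]
    exact csInf_mem ⟨⊤, by simpa using hr⟩
  constructor
  · intro h
    refine le_trans hmem (Finset.card_le_card fun i hi => ?_)
    simp only [Finset.mem_filter, Finset.mem_univ, true_and] at hi ⊢
    exact hi.trans h
  · exact fun h => iInf₂_le t h

variable (μ ν : Measure ℝ)

lemma cumLLR_hist (y : ℕ → Fin s → ℝ) (i : Fin s) {n k : ℕ} (hnk : n ≤ k) :
    cumLLR μ ν (hist y k) i n = walk (llr μ ν) y i n := by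
  unfold cumLLR hist walk
  rw [Fin.sum_univ_eq_sum_range (fun j => if j < n then llr μ ν (y j i) else 0),
    ← Finset.sum_filter]
  congr 1
  ext j
  simp only [Finset.mem_filter, Finset.mem_range]
  omega

/-- The right side does not involve k: crossings up to time n look the same from every later
history. -/
lemma tauPlus_hist_le_iff (b : ℝ) (y : ℕ → Fin s → ℝ) (i : Fin s) {n k : ℕ} (hnk : n ≤ k) :
    tauPlus μ ν b (hist y k) i ≤ n ↔ ∃ m, 1 ≤ m ∧ m ≤ n ∧ b ≤ walk (llr μ ν) y i m := by
  rw [tauPlus, iInf_natCast_le_iff]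
  constructor
  · rintro ⟨m, hm, h1, hmk, h⟩
    exact ⟨m, h1, hm, cumLLR_hist μ ν y i hmk ▸ h⟩
  · rintro ⟨m, h1, hm, h⟩
    exact ⟨m, hm, h1, hm.trans hnk, (cumLLR_hist μ ν y i (hm.trans hnk)).symm ▸ h⟩

lemma tauMinus_hist_le_iff (a : ℝ) (y : ℕ → Fin s → ℝ) (i : Fin s) {n k : ℕ} (hnk : n ≤ k) :
    tauMinus μ ν a (hist y k) i ≤ n ↔
      ∃ m, 1 ≤ m ∧ m ≤ n ∧ a ≤ walk (fun t => -llr μ ν t) y i m := by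
  have hw : ∀ m, walk (fun t => -llr μ ν t) y i m = -walk (llr μ ν) y i m := fun m => by
    simp [walk]
  rw [tauMinus, iInf_natCast_le_iff]
  constructor
  · rintro ⟨m, hm, h1, hmk, h⟩
    rw [cumLLR_hist μ ν y i hmk] at h
    exact ⟨m, h1, hm, by rw [hw]; linarith⟩
  · rintro ⟨m, h1, hm, h⟩
    rw [hw] at h
    exact ⟨m, hm, h1, hm.trans hnk, by rw [cumLLR_hist μ ν y i (hm.trans hnk)]; linarith⟩

lemma orderStat_tauPlus_le_iff {r : ℕ} (hr : r ≤ s) (b : ℝ) (y : ℕ → Fin s → ℝ) {n k : ℕ}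
    (hnk : n ≤ k) :
    orderStat r (tauPlus μ ν b (hist y k)) ≤ n ↔
      r ≤ {i | ∃ m, 1 ≤ m ∧ m ≤ n ∧ b ≤ walk (llr μ ν) y i m}.ncard := by
  rw [orderStat_le_iff hr, ← Set.ncard_coe_finset]
  simp [tauPlus_hist_le_iff μ ν b y _ hnk]

lemma orderStat_tauMinus_le_iff {r : ℕ} (hr : r ≤ s) (a : ℝ) (y : ℕ → Fin s → ℝ) {n k : ℕ}
    (hnk : n ≤ k) :
    orderStat r (tauMinus μ ν a (hist y k)) ≤ n ↔
      r ≤ {i | ∃ m, 1 ≤ m ∧ m ≤ n ∧ a ≤ walk (fun t => -llr μ ν t) y i m}.ncard := by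
  rw [orderStat_le_iff hr, ← Set.ncard_coe_finset]
  simp [tauMinus_hist_le_iff μ ν a y _ hnk]

/-- The increments that push a walk towards accepting hypothesis `d`. -/
noncomputable def signedLLR : Bool → ℝ → ℝ
  | false => fun t => -llr μ ν t
  | true => llr μ ν

lemma measurable_signedLLR (d : Bool) : Measurable (signedLLR μ ν d) := by
  cases d
  · exact (measurable_llr μ ν).neg
  · exact measurable_llr μ ν

lemma signedLLR_not (d : Bool) (t : ℝ) : signedLLR μ ν (!d) t = -signedLLR μ ν d t := by
  cases d <;> simp [signedLLR]

/-- The threshold for accepting hypothesis `d`. -/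
def threshold (a b : ℝ) : Bool → ℝ
  | false => a
  | true => b

lemma stopTime_voting_le {r : ℕ} (hr1 : 1 ≤ r) (hr : r ≤ s) (a b : ℝ) (coin : Bool)
    (y : ℕ → Fin s → ℝ) (d : Bool) {n : ℕ}
    (h : r ≤ {i | ∃ m, 1 ≤ m ∧ m ≤ n ∧
      threshold a b d ≤ walk (signedLLR μ ν d) y i m}.ncard) :
    stopTime (voting μ ν r a b) coin y ≤ n := by
  classical
  -- At the first k with `p k` the minimum equals k exactly, which is when the rule issues a
  -- decision.
  set p : ℕ → Prop := fun k => min (orderStat r (tauMinus μ ν a (hist y k)))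
    (orderStat r (tauPlus μ ν b (hist y k))) ≤ k with hp
  have hpn : p n := by
    cases d
    · exact min_le_of_left_le ((orderStat_tauMinus_le_iff μ ν hr a y le_rfl).2 h)
    · exact min_le_of_right_le ((orderStat_tauPlus_le_iff μ ν hr b y le_rfl).2 h)
  have hex : ∃ k, p k := ⟨n, hpn⟩
  obtain ⟨k, hk, hkn, hmin⟩ : ∃ k, p k ∧ k ≤ n ∧ ∀ j < k, ¬ p j :=
    ⟨Nat.find hex, Nat.find_spec hex, Nat.find_min' hex hpn, fun j hj => Nat.find_min hex hj⟩
  have hk1 : 1 ≤ k := by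
    by_contra h0
    obtain rfl : k = 0 := by omega
    have hempty : ∀ ψ : ℝ → ℝ, ∀ e : ℝ,
        {i : Fin s | ∃ m, 1 ≤ m ∧ m ≤ 0 ∧ e ≤ walk ψ y i m} = ∅ := fun ψ e => by
      ext i
      simp only [Set.mem_ofPred_eq, Set.mem_empty_iff_false, iff_false]
      rintro ⟨m, h1, h2, -⟩
      omega
    rcases min_le_iff.1 hk with h' | h'
    · rw [orderStat_tauMinus_le_iff μ ν hr a y le_rfl, hempty, Set.ncard_empty] at h'
      omega
    · rw [orderStat_tauPlus_le_iff μ ν hr b y le_rfl, hempty, Set.ncard_empty] at h'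
      omega
  have heq : min (orderStat r (tauMinus μ ν a (hist y k)))
      (orderStat r (tauPlus μ ν b (hist y k))) = k := by
    -- A minimum j < k would already be visible in the history of length j, contradicting minimality
    -- of k.
    refine le_antisymm hk (not_lt.1 fun hlt => ?_)
    obtain ⟨j, hj⟩ := ENat.ne_top_iff_exists.1 (ne_top_of_lt hlt)
    rw [← hj, Nat.cast_lt] at hlt
    refine hmin j hlt ?_
    rcases min_le_iff.1 hj.ge with h' | h'
    · exact min_le_of_left_le ((orderStat_tauMinus_le_iff μ ν hr a y le_rfl).2
        ((orderStat_tauMinus_le_iff μ ν hr a y hlt.le).1 h'))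
    · exact min_le_of_right_le ((orderStat_tauPlus_le_iff μ ν hr b y le_rfl).2
        ((orderStat_tauPlus_le_iff μ ν hr b y hlt.le).1 h'))
  refine iInf_natCast_le_iff.2 ⟨k, hkn, hk1, ?_⟩
  simp only [voting, heq, lt_irrefl, if_false]
  rcases lt_trichotomy (orderStat r (tauMinus μ ν a (hist y k)))
    (orderStat r (tauPlus μ ν b (hist y k))) with hlt | he | hlt
  · rw [min_eq_left hlt.le] at heq
    rw [heq] at hlt
    simp [hlt, heq]
  · rw [he, min_self] at heq
    simp [he, heq]
  · rw [min_eq_right hlt.le] at heq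
    rw [heq] at hlt
    simp [hlt, heq, hlt.ne]

lemma Decides.le_ncard {r : ℕ} (hr : r ≤ s) {a b : ℝ} {coin : Bool} {y : ℕ → Fin s → ℝ}
    {d : Bool} (h : Decides (voting μ ν r a b) coin y d) :
    r ≤ {i | ∃ m, threshold a b d ≤ walk (signedLLR μ ν d) y i m}.ncard := by
  obtain ⟨k, -, hk⟩ := h
  have hmono : ∀ ψ : ℝ → ℝ, ∀ e : ℝ,
      {i : Fin s | ∃ m, 1 ≤ m ∧ m ≤ k ∧ e ≤ walk ψ y i m}.ncard ≤
        {i : Fin s | ∃ m, e ≤ walk ψ y i m}.ncard := fun ψ e =>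
    Set.ncard_le_ncard (fun i ⟨m, _, _, hm⟩ => ⟨m, hm⟩) (Set.toFinite _)
  have hor : (d = false → orderStat r (tauMinus μ ν a (hist y k)) ≤ k) ∧
      (d = true → orderStat r (tauPlus μ ν b (hist y k)) ≤ k) := by
    simp only [voting] at hk
    split_ifs at hk with h1 h2 h3 h4
    · obtain rfl := Option.some_injective _ hk
      simp [h2.1.ge]
    · obtain rfl := Option.some_injective _ hk
      simp [h3.1.ge]
    -- In a tie both order statistics equal k, so the coin does not matter.
    · exact ⟨fun _ => h4.2 ▸ h4.1.ge, fun _ => h4.1.ge⟩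
  cases d
  · exact ((orderStat_tauMinus_le_iff μ ν hr a y le_rfl).1 (hor.1 rfl)).trans (hmono _ _)
  · exact ((orderStat_tauPlus_le_iff μ ν hr b y le_rfl).1 (hor.2 rfl)).trans (hmono _ _)

lemma one_le_stopTime (f : Detector s) (coin : Bool) (y : ℕ → Fin s → ℝ) :
    1 ≤ stopTime f coin y :=
  le_iInf₂ fun _ hk => Nat.one_le_cast.2 hk.1

end VotingRule

/-! ### Error and delay bounds under attack. -/

section Bounds

variable {s : ℕ} {R : Type*} [MeasurableSpace R]

lemma Attack.walk_received (g : Attack s R) (ψ : ℝ → ℝ) (θ : Bool) (w : R) (x : ℕ → Fin s → ℝ)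
    {i : Fin s} (hi : i ∉ g.compromised) (n : ℕ) :
    walk ψ (g.received θ w x) i n = walk ψ x i n := by
  simp [walk, Attack.received, Attack.biasAt, g.sparse _ _ _ _ _ i hi]

variable (μ ν : Measure ℝ) [IsProbabilityMeasure μ] [IsProbabilityMeasure ν]

instance (θ : Bool) : IsProbabilityMeasure (obsLaw μ ν θ) := by
  cases θ <;> assumption

instance (ρ : Measure R) [IsProbabilityMeasure ρ] (θ : Bool) :
    IsProbabilityMeasure (jointLaw s μ ν ρ θ) := by
  unfold jointLaw
  infer_instance

/-- `E` is arbitrary because the product formula for rectangles needs no measurability. -/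
lemma jointLaw_observations (ρ : Measure R) [IsProbabilityMeasure ρ] (θ : Bool)
    (E : Set (ℕ → Fin s → ℝ)) :
    jointLaw s μ ν ρ θ {ω | ω.2.2 ∈ E} =
      Measure.infinitePi (fun _ : ℕ => Measure.pi fun _ : Fin s => obsLaw μ ν θ) E := by
  have : {ω : Bool × R × (ℕ → Fin s → ℝ) | ω.2.2 ∈ E} = Set.univ ×ˢ (Set.univ ×ˢ E) := by
    ext; simp
  rw [this, jointLaw, Measure.prod_prod, Measure.prod_prod, measure_univ, measure_univ, one_mul, one_mul]

/-- The exponential of the log-likelihood ratio is the density dμ/dν, ν-almost everywhere. -/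
lemma lintegral_exp_llr_le_one (hνμ : ν ≪ μ) :
    ∫⁻ t, ENNReal.ofReal (Real.exp (llr μ ν t)) ∂ν ≤ 1 := by
  calc _ = ∫⁻ t, ENNReal.ofReal (μ.rnDeriv ν t).toReal ∂ν := by
        refine lintegral_congr_ae ?_
        filter_upwards [exp_llr_of_ac' μ ν hνμ] with t ht
        rw [ht]
    _ ≤ ∫⁻ t, μ.rnDeriv ν t ∂ν := lintegral_mono fun t => ENNReal.ofReal_toReal_le
    _ ≤ μ Set.univ := Measure.lintegral_rnDeriv_le
    _ = 1 := measure_univ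

lemma lintegral_exp_neg_llr_le_one (hμν : μ ≪ ν) :
    ∫⁻ t, ENNReal.ofReal (Real.exp (-llr μ ν t)) ∂μ ≤ 1 := by
  refine le_trans (lintegral_congr_ae ?_).le (lintegral_exp_llr_le_one ν μ hμν)
  filter_upwards [neg_llr hμν] with t ht
  rw [← ht, Pi.neg_apply]

lemma lintegral_exp_signedLLR_not_le_one (hμν : μ ≪ ν) (hνμ : ν ≪ μ) (θ : Bool) :
    ∫⁻ t, ENNReal.ofReal (Real.exp (signedLLR μ ν (!θ) t)) ∂(obsLaw μ ν θ) ≤ 1 := by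
  cases θ
  · exact lintegral_exp_llr_le_one μ ν hνμ
  · exact lintegral_exp_neg_llr_le_one μ ν hμν

/-- The probability of a wrong decision under the voting rule. -/
lemma probDecides_not_voting_le (hμν : μ ≪ ν) (hνμ : ν ≪ μ) (ρ : Measure R)
    [IsProbabilityMeasure ρ] (g : Attack s R) {r κ : ℕ} (hr : r ≤ s)
    (hκ : κ + g.compromised.card ≤ r) (a b : ℝ) (θ : Bool) :
    probDecides μ ν ρ (voting μ ν r a b) g θ (!θ) ≤
      ENNReal.ofReal (2 ^ s * Real.exp (-(κ * threshold a b (!θ)))) := by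
  set ψ := signedLLR μ ν (!θ)
  set e := threshold a b (!θ)
  set E : Finset (Fin s) → Set (ℕ → Fin s → ℝ) := fun A => {x | ∀ i ∈ A, ∃ k, e ≤ walk ψ x i k}
  set F : Finset (Finset (Fin s)) := Finset.powersetCard κ Finset.univ
  calc probDecides μ ν ρ (voting μ ν r a b) g θ (!θ)
      ≤ jointLaw s μ ν ρ θ {ω | ω.2.2 ∈ ⋃ A ∈ F, E A} := by
        refine measure_mono fun ω hω => ?_
        have h1 := Decides.le_ncard μ ν hr hω
        set C := {i | ∃ m, e ≤ walk ψ (g.received θ ω.2.1 ω.2.2) i m}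
        -- Discarding the compromised sensors from at least r crossing ones leaves at least κ.
        have h2 : κ ≤ (C \ g.compromised).ncard := by
          have := Set.ncard_le_ncard_sdiff_add_ncard C (g.compromised : Set (Fin s))
          rw [Set.ncard_coe_finset] at this
          change r ≤ C.ncard at h1
          omega
        obtain ⟨A, hA, hAc⟩ := Set.exists_subset_card_eq h2
        have hfin : A.Finite := Set.toFinite A
        simp only [Set.mem_ofPred_eq, Set.mem_iUnion]
        refine ⟨hfin.toFinset, ?_, fun i hi => ?_⟩
        · rw [Finset.mem_powersetCard, ← Set.ncard_eq_toFinset_card A hfin]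
          exact ⟨Finset.subset_univ _, hAc⟩
        · obtain ⟨⟨k, hk⟩, hi'⟩ := hA (hfin.mem_toFinset.1 hi)
          exact ⟨k, by rwa [g.walk_received ψ θ _ _ hi'] at hk⟩
    _ = Measure.infinitePi (fun _ : ℕ => Measure.pi fun _ : Fin s => obsLaw μ ν θ)
          (⋃ A ∈ F, E A) := jointLaw_observations μ ν ρ θ _
    _ ≤ ∑ A ∈ F, Measure.infinitePi (fun _ : ℕ => Measure.pi fun _ : Fin s => obsLaw μ ν θ)
          (E A) := measure_biUnion_finset_le _ _
    _ ≤ ∑ A ∈ F, ENNReal.ofReal (Real.exp (-(κ * e))) := by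
        refine Finset.sum_le_sum fun A hA => ?_
        rw [← (Finset.mem_powersetCard.1 hA).2]
        exact measure_forall_exists_le_walk_le _ (measurable_signedLLR μ ν _)
          (lintegral_exp_signedLLR_not_le_one μ ν hμν hνμ θ) A e
    _ ≤ ENNReal.ofReal (2 ^ s * Real.exp (-(κ * e))) := by
        rw [Finset.sum_const, ENNReal.ofReal_mul (by positivity), nsmul_eq_mul,
          ENNReal.ofReal_pow (by norm_num), ENNReal.ofReal_ofNat]
        gcongr
        rw [Finset.card_powersetCard, Finset.card_univ, Fintype.card_fin]
        exact_mod_cast Nat.choose_le_two_pow s κ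

/-- T is the sum over n of the indicator of n < T; this form also covers T = ⊤. -/
lemma toENNReal_le_tsum_of_forall_lt (T : ℕ∞) {u : ℕ → ℝ≥0∞} (hu : ∀ n : ℕ, n < T → 1 ≤ u n) :
    (T : ℝ≥0∞) ≤ ∑' n, u n := by
  have hN : ∀ N : ℕ, (N : ℕ∞) ≤ T → (N : ℝ≥0∞) ≤ ∑' n, u n := fun N hN => by
    calc (N : ℝ≥0∞) = ∑ n ∈ Finset.range N, 1 := by simp
      _ ≤ ∑ n ∈ Finset.range N, u n := Finset.sum_le_sum fun n hn => hu n
          ((Nat.cast_lt.2 (Finset.mem_range.1 hn)).trans_le hN)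
      _ ≤ _ := ENNReal.sum_le_tsum _
  cases T with
  | top =>
    rw [ENat.toENNReal_top, top_le_iff]
    exact ENNReal.eq_top_of_forall_nnreal_le fun q =>
      (ENNReal.coe_le_coe.2 (Nat.le_ceil q)).trans (by simpa using hN ⌈q⌉₊ le_top)
  | coe N => simpa using hN N le_rfl

/-- The mean stopping time of the voting rule grows at most at the rate of the drift. -/
lemma exists_meanStop_voting_le (hμν : μ ≪ ν) (hνμ : ν ≪ μ) (ρ : Measure R)
    [IsProbabilityMeasure ρ] (g : Attack s R) {r : ℕ} (hr1 : 1 ≤ r)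
    (hr : r + g.compromised.card ≤ s) (θ : Bool)
    (hint : Integrable (signedLLR μ ν θ) (obsLaw μ ν θ)) {η : ℝ} (hη0 : 0 < η)
    (hη : η < ∫ t, signedLLR μ ν θ t ∂(obsLaw μ ν θ)) :
    ∃ K : ℝ, 0 ≤ K ∧ ∀ a b : ℝ, 0 < a → 0 < b →
      meanStop μ ν ρ (voting μ ν r a b) g θ ≤ ENNReal.ofReal (threshold a b θ / η + K) := by
  set φ := signedLLR μ ν θ with hφ
  have hφm : Measurable φ := measurable_signedLLR μ ν θ
  obtain ⟨q, hq1, hq⟩ := exists_measure_walk_lt_le (s := s) (obsLaw μ ν θ) hφm hint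
    (by simpa only [signedLLR_not] using lintegral_exp_signedLLR_not_le_one μ ν hμν hνμ θ) hη
  have hfin : (s : ℝ≥0∞) * (1 - q)⁻¹ ≠ ⊤ :=
    ENNReal.mul_ne_top (ENNReal.natCast_ne_top s)
      (ENNReal.inv_ne_top.2 (tsub_pos_iff_lt.2 hq1).ne')
  -- The 1 pays for rounding e/η up, the rest is the geometric series of the s tail bounds.
  refine ⟨1 + ((s : ℝ≥0∞) * (1 - q)⁻¹).toReal, by positivity, fun a b ha hb => ?_⟩
  set e := threshold a b θ
  have he : 0 < e := by cases θ <;> assumption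
  set Q := Measure.infinitePi (fun _ : ℕ => Measure.pi fun _ : Fin s => obsLaw μ ν θ)
  -- Outside `B n` every honest walk has crossed, so the test has stopped by time n.
  set B : ℕ → Set (ℕ → Fin s → ℝ) := fun n => ⋃ i, {x | walk φ x i n < e}
  have hB : ∀ n, MeasurableSet (B n) := fun n =>
    MeasurableSet.iUnion fun i => measurableSet_lt (measurable_walk hφm i n) measurable_const
  set N := ⌈e / η⌉₊
  calc meanStop μ ν ρ (voting μ ν r a b) g θ
      ≤ ∫⁻ ω, ∑' n, {ω : Bool × R × (ℕ → Fin s → ℝ) | ω.2.2 ∈ B n}.indicator 1 ω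
          ∂(jointLaw s μ ν ρ θ) := by
        refine lintegral_mono fun ω => toENNReal_le_tsum_of_forall_lt _ fun n hn => ?_
        suffices ω.2.2 ∈ B n by
          rw [Set.indicator_of_mem (show ω ∈ {ω : Bool × R × (ℕ → Fin s → ℝ) | ω.2.2 ∈ B n}
            from this)]
          exact le_rfl
        by_contra hnot
        simp only [B, Set.mem_iUnion, Set.mem_ofPred_eq, not_exists, not_lt] at hnot
        refine hn.not_ge (stopTime_voting_le μ ν hr1 (by omega) a b _ _ θ ?_)
        have hn1 : 1 ≤ n := by
          by_contra h0
          obtain rfl : n = 0 := by omega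
          have := hnot ⟨0, by omega⟩
          simp only [walk, Finset.range_zero, Finset.sum_empty] at this
          linarith
        calc r ≤ (g.compromisedᶜ).card := by
              rw [Finset.card_compl, Fintype.card_fin]; omega
          _ = ((g.compromisedᶜ : Finset (Fin s)) : Set (Fin s)).ncard :=
              (Set.ncard_coe_finset _).symm
          _ ≤ _ := Set.ncard_le_ncard (fun i hi => by
              refine ⟨n, hn1, le_rfl, ?_⟩
              rw [g.walk_received _ θ _ _ (by simpa using hi)]
              exact hnot i) (Set.toFinite _)
    _ = ∑' n, Q (B n) := by
        have hB' : ∀ n, MeasurableSet {ω : Bool × R × (ℕ → Fin s → ℝ) | ω.2.2 ∈ B n} :=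
          fun n => measurable_snd.comp measurable_snd (hB n)
        rw [lintegral_tsum fun n => (measurable_one.indicator (hB' n)).aemeasurable]
        congr 1 with n
        rw [lintegral_indicator_one (hB' n), jointLaw_observations]
    _ ≤ ∑' n, ((if n ∈ Finset.range N then 1 else 0) + s * q ^ n) := by
        refine ENNReal.tsum_le_tsum fun n => ?_
        by_cases hn : n ∈ Finset.range N
        · rw [if_pos hn]
          exact prob_le_one.trans le_self_add
        · rw [if_neg hn, zero_add]
          have hn' : e ≤ n * η := by
            rw [← div_le_iff₀ hη0]
            exact Nat.ceil_le.1 (not_lt.1 fun h => hn (Finset.mem_range.2 h))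
          calc Q (B n) ≤ ∑ i, Q {x | walk φ x i n < e} := by
                simpa using measure_iUnion_fintype_le Q fun i => {x | walk φ x i n < e}
            _ ≤ ∑ i : Fin s, q ^ n := Finset.sum_le_sum fun i _ => hq n e i hn'
            _ = s * q ^ n := by simp
    _ = N + s * (1 - q)⁻¹ := by
        rw [ENNReal.tsum_add, ENNReal.tsum_mul_left, ENNReal.tsum_geometric,
          tsum_eq_sum (s := Finset.range N) (fun n hn => if_neg hn)]
        congr 1
        rw [Finset.sum_congr rfl fun n hn => if_pos hn]
        simp
    _ ≤ ENNReal.ofReal (e / η + (1 + ((s : ℝ≥0∞) * (1 - q)⁻¹).toReal)) := by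
        rw [← add_assoc, ENNReal.ofReal_add (by positivity) ENNReal.toReal_nonneg,
          ENNReal.ofReal_toReal hfin]
        gcongr
        rw [← ENNReal.ofReal_natCast]
        exact ENNReal.ofReal_le_ofReal (Nat.ceil_lt_add_one (by positivity)).le

lemma one_le_delay (ρ : Measure R) [IsProbabilityMeasure ρ] (f : Detector s) (g : Attack s R) :
    1 ≤ delay μ ν ρ f g := by
  refine le_max_of_le_left ?_
  calc (1 : ℝ≥0∞) = ∫⁻ _, 1 ∂(jointLaw s μ ν ρ false) := by simp
    _ ≤ _ := lintegral_mono fun ω => by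
        simpa using ENat.toENNReal_mono (one_le_stopTime f ω.1 (g.received false ω.2.1 ω.2.2))

end Bounds
-- From the two bounds to the efficiency.
lemma le_log_inv_div {κ C v η K : ℝ} (hκ : 0 < κ) (hη : 0 < η) (hv : 0 ≤ v) (hvη : v < κ * η) :
    ∃ L₀ : ℝ, ∀ (m : ℝ) (p D : ℝ≥0∞), 1 ≤ D → D ≤ ENNReal.ofReal (m / η + K) →
      p ≤ ENNReal.ofReal (Real.exp (C - κ * m)) → p ≤ ENNReal.ofReal (Real.exp (-L₀)) →
      (v : EReal) ≤ ENNReal.log p⁻¹ / (D : EReal) := by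
  refine ⟨(v * C + v * K * (κ * η)) / (κ * η - v), fun m p D hD1 hD hp hp0 => ?_⟩
  set L₀ := (v * C + v * K * (κ * η)) / (κ * η - v) with hL₀
  have hδ : 0 < κ * η - v := sub_pos.2 hvη
  have hdpos : 0 < m / η + K := by
    have := hD1.trans hD
    rw [ENNReal.one_le_ofReal] at this
    linarith
  have hDtop : D ≠ ⊤ := ne_top_of_le_ne_top ENNReal.ofReal_ne_top hD
  rw [EReal.le_div_iff_mul_le (by exact_mod_cast zero_lt_one.trans_le hD1)
    (by simpa using hDtop)]
  -- Small p need not force m to be large, so both lower bounds on log(1/p) are kept. The first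
  -- gives vκm ≤ v(L + C); L ≥ L₀ absorbs the constants into the slack (κη - v)L.
  set L := max (κ * m - C) L₀ with hL
  have hpL : p ≤ ENNReal.ofReal (Real.exp (-L)) := by
    rcases max_choice (κ * m - C) L₀ with h | h
    · rw [hL, h, neg_sub]; exact hp
    · rw [hL, h]; exact hp0
  calc (v : EReal) * D ≤ v * ((m / η + K : ℝ) : EReal) := by
        refine mul_le_mul_of_nonneg_left ?_ (by exact_mod_cast hv)
        rw [← max_eq_left hdpos.le, ← EReal.coe_ennreal_ofReal]
        exact EReal.coe_ennreal_le_coe_ennreal_iff.2 hD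
    _ = ((v * (m / η + K) : ℝ) : EReal) := by push_cast; rfl
    _ ≤ (L : EReal) := by
        rw [EReal.coe_le_coe_iff]
        have h1 : κ * m - C ≤ L := le_max_left _ _
        have h2 : v * C + v * K * (κ * η) ≤ L * (κ * η - v) := by
          rw [← div_le_iff₀ hδ]; exact le_max_right _ _
        have h3 : v * (m / η + K) * (κ * η) = v * (κ * m) + v * K * (κ * η) := by
          field_simp
        refine le_of_mul_le_mul_right ?_ (mul_pos hκ hη)
        have h4 := mul_le_mul_of_nonneg_left h1 hv
        rw [h3]
        linarith
    _ = -ENNReal.log (ENNReal.ofReal (Real.exp (-L))) := by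
        rw [ENNReal.log_ofReal_of_pos (Real.exp_pos _), Real.log_exp]
        simp
    _ ≤ ENNReal.log p⁻¹ := by
        rw [ENNReal.log_inv]
        exact EReal.neg_le_neg_iff.2 (ENNReal.log_le_log hpL)

section

variable {R : Type*} [MeasurableSpace R] {s : ℕ} (μ ν : Measure ℝ) [IsProbabilityMeasure μ]
  [IsProbabilityMeasure ν]

/-- Below the rate `κ I`, the efficiency of the voting rule is bounded below as soon as a common
bound `p` of the error probabilities is small. -/
lemma exists_le_efficiency_voting (hμν : μ ≪ ν) (hνμ : ν ≪ μ)
    (hint₁ : Integrable (llr μ ν) μ) (hint₀ : Integrable (llr μ ν) ν)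
    (hI₁ : 0 < klOne μ ν) (hI₀ : 0 < klZero μ ν)
    (ρ : Measure R) [IsProbabilityMeasure ρ] (g : Attack s R) {r κ : ℕ} (hκ0 : 0 < κ)
    (hκ : κ + g.compromised.card ≤ r) (hr : r + g.compromised.card ≤ s) {v : ℝ}
    (hv : v < κ * klMin μ ν) :
    ∃ L₀ : ℝ, ∀ (a b : ℝ) (p : ℝ≥0∞), 0 < a → 0 < b →
      p ≤ ENNReal.ofReal (2 ^ s * Real.exp (-(κ * max a b))) →
      p ≤ ENNReal.ofReal (Real.exp (-L₀)) →
      (v : EReal) ≤ efficiency μ ν ρ (voting μ ν r a b) g p := by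
  have hκ' : (0 : ℝ) < κ := Nat.cast_pos.2 hκ0
  have hI : 0 < klMin μ ν := lt_min hI₀ hI₁
  -- `max v 0` covers negative v; η lies below the drift in both states and still has κη > v.
  obtain ⟨η, hη1, hη2⟩ : ∃ η, max v 0 / κ < η ∧ η < klMin μ ν := exists_between <| by
    rw [div_lt_iff₀' hκ']
    exact max_lt hv (by positivity)
  have hη0 : 0 < η := lt_of_le_of_lt (by positivity) hη1
  obtain ⟨K₀, hK₀, h₀⟩ := exists_meanStop_voting_le μ ν hμν hνμ ρ g (by omega) hr false hint₀.neg
    hη0 (by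
      change η < ∫ t, -llr μ ν t ∂ν
      rw [integral_neg]
      exact hη2.trans_le (min_le_left _ _))
  obtain ⟨K₁, hK₁, h₁⟩ := exists_meanStop_voting_le μ ν hμν hνμ ρ g (by omega) hr true hint₁
    hη0 (hη2.trans_le (min_le_right _ _))
  obtain ⟨L₀, hL₀⟩ := le_log_inv_div (C := Real.log (2 ^ s)) (K := max K₀ K₁) hκ' hη0
    (le_max_right v 0) ((div_lt_iff₀' hκ').1 hη1)
  refine ⟨L₀, fun a b p ha hb hp hp0 => le_trans (by exact_mod_cast le_max_left v 0)
    (hL₀ (max a b) p (delay μ ν ρ (voting μ ν r a b) g) (one_le_delay μ ν ρ _ g) ?_ ?_ hp0)⟩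
  · refine max_le ((h₀ a b ha hb).trans (ENNReal.ofReal_le_ofReal ?_))
      ((h₁ a b ha hb).trans (ENNReal.ofReal_le_ofReal ?_))
    · exact add_le_add (div_le_div_of_nonneg_right (le_max_left a b) hη0.le) (le_max_left _ _)
    · exact add_le_add (div_le_div_of_nonneg_right (le_max_right a b) hη0.le) (le_max_right _ _)
  · rwa [sub_eq_add_neg, Real.exp_add, Real.exp_log (by positivity)]

end
end ByzantineDetection

open ByzantineDetection in
theorem theorem4 {R : Type*} [MeasurableSpace R] (s c cbar : ℕ) (hc : c ≤ cbar)
    (hcbar : 2 * cbar < s) (μ ν : Measure ℝ) [IsProbabilityMeasure μ] [IsProbabilityMeasure ν]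
    (hμν : μ ≪ ν) (hνμ : ν ≪ μ)
    (hint₁ : Integrable (llr μ ν) μ) (hint₀ : Integrable (llr μ ν) ν)
    (hI₁ : 0 < klOne μ ν) (hI₀ : 0 < klZero μ ν)
    (ρ : Measure R) [IsProbabilityMeasure ρ]
    (g : Attack s R) (hg : g.compromised.card = c) :
    -- the limit `α = β → 0⁺`
    ((((s : ℝ) - cbar - c) * klMin μ ν : ℝ) : EReal) ≤
        gamma μ ν ρ (votingFamily μ ν s (s - cbar)) g ∧
    -- the limit along equal thresholds `a = b → ∞`
    Tendsto (fun a : ℝ => typeI μ ν ρ (voting μ ν (s - cbar) a a) g) atTop (𝓝 0) ∧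
    Tendsto (fun a : ℝ => typeII μ ν ρ (voting μ ν (s - cbar) a a) g) atTop (𝓝 0) ∧
    ((((s : ℝ) - cbar - c) * klMin μ ν : ℝ) : EReal) ≤
        liminf (fun a : ℝ => efficiency μ ν ρ (voting μ ν (s - cbar) a a) g
          (max (typeI μ ν ρ (voting μ ν (s - cbar) a a) g)
            (typeII μ ν ρ (voting μ ν (s - cbar) a a) g))) atTop := by
  obtain ⟨κ, hκ⟩ : ∃ κ : ℕ, κ + cbar + c = s := ⟨s - cbar - c, by omega⟩
  have hκs : (s : ℝ) - cbar - c = κ := by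
    rw [← hκ]; push_cast; ring
  have hκ0 : 0 < κ := by omega
  rw [hκs]
  have hI := fun a b => probDecides_not_voting_le μ ν hμν hνμ ρ g (r := s - cbar) (κ := κ)
    (Nat.sub_le _ _) (by omega) a b false
  have hII := fun a b => probDecides_not_voting_le μ ν hμν hνμ ρ g (r := s - cbar) (κ := κ)
    (Nat.sub_le _ _) (by omega) a b true
  have hzero : Tendsto (fun a : ℝ => ENNReal.ofReal (2 ^ s * Real.exp (-(κ * a)))) atTop (𝓝 0) := by
    rw [← ENNReal.ofReal_zero]
    refine ENNReal.tendsto_ofReal ?_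
    rw [← mul_zero ((2 : ℝ) ^ s)]
    refine Tendsto.const_mul _ (Real.tendsto_exp_neg_atTop_nhds_zero.comp ?_)
    exact tendsto_id.const_mul_atTop (Nat.cast_pos.2 hκ0)
  have hsmall : ∀ v : ℝ, v < κ * klMin μ ν → _ := fun v hv =>
    exists_le_efficiency_voting μ ν hμν hνμ hint₁ hint₀ hI₁ hI₀ ρ g (r := s - cbar) hκ0
      (by omega) (by omega) hv
  refine ⟨EReal.ge_of_forall_gt_iff_ge.1 fun v hv => ?_, ?_, ?_,
    EReal.ge_of_forall_gt_iff_ge.1 fun v hv => ?_⟩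
  · obtain ⟨L₀, hL₀⟩ := hsmall v (EReal.coe_lt_coe_iff.1 hv)
    refine le_liminf_of_le (by isBoundedDefault) ?_
    rw [eventually_inf_principal]
    have hev : ∀ᶠ q : ℝ≥0∞ in 𝓝[>] 0, q ≤ ENNReal.ofReal (Real.exp (-L₀)) :=
      eventually_nhdsWithin_of_eventually_nhds
        (Iic_mem_nhds (ENNReal.ofReal_pos.2 (Real.exp_pos _)))
    filter_upwards [tendsto_comap.eventually hev] with t ht heq
    refine hL₀ t.1.1 t.1.2 _ t.2.1 t.2.2 ?_ ht
    -- The type-I bound involves b and the type-II bound a; since α = β, the one with the larger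
    -- threshold applies.
    rcases max_choice t.1.1 t.1.2 with h | h
    · rw [h, heq]; exact hII t.1.1 t.1.2
    · rw [h]; exact hI t.1.1 t.1.2
  · exact tendsto_of_tendsto_of_tendsto_of_le_of_le tendsto_const_nhds hzero
      (fun _ => zero_le) fun a => hI a a
  · exact tendsto_of_tendsto_of_tendsto_of_le_of_le tendsto_const_nhds hzero
      (fun _ => zero_le) fun a => hII a a
  · obtain ⟨L₀, hL₀⟩ := hsmall v (EReal.coe_lt_coe_iff.1 hv)
    refine le_liminf_of_le (by isBoundedDefault) ?_
    filter_upwards [eventually_gt_atTop 0, hzero.eventually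
      (Iic_mem_nhds (ENNReal.ofReal_pos.2 (Real.exp_pos (-L₀))))] with a ha hsm
    have hp := max_le (hI a a) (hII a a)
    exact hL₀ a a _ ha ha (by rw [max_self]; exact hp) (hp.trans hsm)
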